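/- Let $(\Omega,\mathcal F,P)$ be a probability space and let $L^0$ be the space of real random variables modulo $P$-almost sure equality, with the almost sure order and the topology of convergence in probability. Let the ambient space $\mathcal X$ be either (1) $L^\infty$ with the weak-star topology $\sigma(L^\infty,L^1)$, or (2) a linear subspace of $L^0$ with a topology making it a Fréchet lattice (a completely metrizable, locally solid Riesz space, not necessarily locally convex) such that: $X_n\downarrow 0$ a.s. with $X_n\in\mathcal X$ implies $X_n\to0$ in $\mathcal X$; $L^\infty\subset\mathcal X\subset L^0$ with both inclusions continuous and with dense image, $L^\infty$ carrying the sup-norm; and $1_AX\in\mathcal X$ for all $X\in\mathcal X$, $A\in\mathcal F$. For $A\in\mathcal F$ put $\mathcal X(A)=\{1_AX : X\in\mathcal X\}$ and $\mathcal X_+(A)=\{X\in\mathcal X(A): X\ge 0\}$. An acceptance set is a set $\emptyset\ne\mathcal A\subsetneq\mathcal X$ such that $X\in\mathcal A$, $Y\in\mathcal X$, $Y\ge X$ imply $Y\in\mathcal A$. It is coherent if it is a convex cone, and surplus invariant if $X\in\mathcal A$, $Y\in\mathcal X$, $Y^-\le X^-$ imply $Y\in\mathcal A$, where $X^-=\max\{-X,0\}$.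 **Theorem.** Let $\mathcal A\subset\mathcal X$ be a closed, coherent acceptance set. Then $\mathcal A$ is surplus invariant if and only if there exists $A\in\mathcal F$ with $P(A)>0$ such that $$\mathcal A=\mathcal X_+(A)\oplus\mathcal X(A^c)=\{X\in\mathcal X : 1_AX\ge 0\},$$ where $\mathcal C\oplus\mathcal D$ denotes the set of all sums $C+D$ with $C\in\mathcal C$, $D\in\mathcal D$, the decomposition of each element being unique. -/

import Mathlib

open MeasureTheory Filter Topology
open scoped ENNReal Pointwise

noncomputable section

namespace SurplusInvariance

variable {Ω : Type*} [MeasurableSpace Ω]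

/-- `L⁰(Ω, F, P)`: real random variables modulo almost sure equality, with the
almost sure pointwise order (Mathlib's vector lattice structure on `Ω →ₘ[P] ℝ`). -/
abbrev L0 (P : Measure Ω) : Type _ := Ω →ₘ[P] ℝ

/-- The topology of convergence in probability on `L⁰`: a set is open if around each of its
points `X` it contains a ball `{Y | P(|Y - X| ≥ ε) < ε}` with `ε > 0`. -/
@[reducible] def probTopology (P : Measure Ω) : TopologicalSpace (L0 P) where
  IsOpen U := ∀ X ∈ U, ∃ ε : ℝ, 0 < ε ∧
    ∀ Y : L0 P, P {ω | ε ≤ |Y ω - X ω|} < ENNReal.ofReal ε → Y ∈ U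
  isOpen_univ := fun _ _ => ⟨1, one_pos, fun _ _ => trivial⟩
  isOpen_inter := by
    rintro U V hU hV X ⟨hXU, hXV⟩
    obtain ⟨a, ha, hUa⟩ := hU X hXU
    obtain ⟨b, hb, hVb⟩ := hV X hXV
    refine ⟨min a b, lt_min ha hb, fun Y hY => ⟨hUa Y ?_, hVb Y ?_⟩⟩
    · refine lt_of_le_of_lt (measure_mono fun ω hω => ?_)
        (hY.trans_le (ENNReal.ofReal_le_ofReal (min_le_left a b)))
      exact (min_le_left a b).trans hω
    · refine lt_of_le_of_lt (measure_mono fun ω hω => ?_)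
        (hY.trans_le (ENNReal.ofReal_le_ofReal (min_le_right a b)))
      exact (min_le_right a b).trans hω
  isOpen_sUnion := by
    rintro S hS X ⟨U, hUS, hXU⟩
    obtain ⟨ε, hε, h⟩ := hS U hUS X hXU
    exact ⟨ε, hε, fun Y hY => ⟨U, hUS, h Y hY⟩⟩

/-- The (class of the) indicator function `1_A` of an event `A`. -/
def ind (P : Measure Ω) {A : Set Ω} (hA : MeasurableSet A) : L0 P :=
  AEEqFun.mk (A.indicator fun _ => (1 : ℝ)) (aestronglyMeasurable_const.indicator hA)

/-- `L^∞` as a linear subspace of `L⁰`. -/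
abbrev Linfty (P : Measure Ω) : Submodule ℝ (L0 P) := Lp.LpSubmodule ℝ ℝ ∞ P

/-- The weak-star topology `σ(L^∞, L¹)`: the coarsest topology making all the functionals
`X ↦ E[X Z]`, `Z ∈ L¹`, continuous. -/
@[reducible] def weakStarTopology (P : Measure Ω) : TopologicalSpace (Linfty P) :=
  TopologicalSpace.induced
    (fun (X : Linfty P) (Z : Lp ℝ 1 P) => ∫ ω, (X : L0 P) ω * (Z : L0 P) ω ∂P) Pi.topologicalSpace

/-- A linear subspace `X` of `L⁰` with a topology making it a Fréchet lattice (a completely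
metrizable, locally solid Riesz space for the order of `L⁰`; local convexity is not required)
that has the `σ`-Lebesgue property, the dense continuous embeddings
`L^∞ (sup-norm) ↪ X ↪ L⁰`, and the localization property. -/
structure IsFrechetAmbient (P : Measure Ω) (X : Submodule ℝ (L0 P)) [TopologicalSpace X] :
    Prop where
  sup_mem : ∀ f ∈ X, ∀ g ∈ X, f ⊔ g ∈ X
  isTopologicalAddGroup : IsTopologicalAddGroup X
  continuousSMul : ContinuousSMul ℝ X
  isCompletelyMetrizable : TopologicalSpace.IsCompletelyMetrizableSpace X
  /-- Solid neighbourhoods of zero form a neighbourhood base at zero. -/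
  locallySolid : ∀ U ∈ 𝓝 (0 : X), ∃ V ∈ 𝓝 (0 : X), V ⊆ U ∧
    ∀ f ∈ V, ∀ g : X, |(g : L0 P)| ≤ |(f : L0 P)| → g ∈ V
  /-- If `u n ↓ 0` almost surely, then `u n → 0` in `X`. -/
  sigmaLebesgue : ∀ u : ℕ → X, Antitone (fun n => (u n : L0 P)) →
    (∀ᵐ ω ∂P, Tendsto (fun n => (u n : L0 P) ω) atTop (𝓝 0)) → Tendsto u atTop (𝓝 0)
  linfty_mem : ∀ f : Lp ℝ ∞ P, (f : L0 P) ∈ X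
  /-- The domain `Lp ℝ ∞ P` carries the essential supremum norm. -/
  continuous_linfty : Continuous (fun f : Lp ℝ ∞ P => (⟨(f : L0 P), linfty_mem f⟩ : X))
  denseRange_linfty : DenseRange (fun f : Lp ℝ ∞ P => (⟨(f : L0 P), linfty_mem f⟩ : X))
  continuous_L0 : @Continuous X (L0 P) _ (probTopology P) (fun f => (f : L0 P))
  denseRange_L0 : @DenseRange (L0 P) (probTopology P) X (fun f => (f : L0 P))
  localization : ∀ {A : Set Ω} (hA : MeasurableSet A), ∀ f ∈ X, ind P hA * f ∈ X

/-- The admissible ambient spaces: `L^∞` with the weak-star topology, or a Fréchet lattice as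
described in `IsFrechetAmbient`. -/
inductive IsAmbientSpace (P : Measure Ω) :
    (X : Submodule ℝ (L0 P)) → TopologicalSpace X → Prop
  | linfty : IsAmbientSpace P (Linfty P) (weakStarTopology P)
  | frechet (X : Submodule ℝ (L0 P)) (τ : TopologicalSpace X) (h : IsFrechetAmbient P X) :
      IsAmbientSpace P X τ

variable {P : Measure Ω} {X : Submodule ℝ (L0 P)}

/-- Acceptance sets: non-empty, strict, monotone subsets of `X`. -/
structure IsAcceptanceSet (𝒜 : Set X) : Prop where
  nonempty : 𝒜.Nonempty
  ne_univ : 𝒜 ≠ Set.univ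
  monotone : ∀ f ∈ 𝒜, ∀ g : X, (f : L0 P) ≤ (g : L0 P) → g ∈ 𝒜

/-- Coherent sets: convex cones. -/
structure IsCoherent (𝒜 : Set X) : Prop where
  convex : Convex ℝ 𝒜
  cone : ∀ f ∈ 𝒜, ∀ c : ℝ, 0 < c → c • f ∈ 𝒜

/-- Surplus invariance: `f ∈ 𝒜` and `g⁻ ≤ f⁻` imply `g ∈ 𝒜`, where `f⁻ = max {-f, 0}`. -/
def IsSurplusInvariant (𝒜 : Set X) : Prop :=
  ∀ f ∈ 𝒜, ∀ g : X, (-(g : L0 P)) ⊔ 0 ≤ (-(f : L0 P)) ⊔ 0 → g ∈ 𝒜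

/-- `X(A) = 1_A X = {1_A f | f ∈ X}`. -/
def localized (X : Submodule ℝ (L0 P)) {A : Set Ω} (hA : MeasurableSet A) : Set X :=
  {g | ∃ f : X, (g : L0 P) = ind P hA * (f : L0 P)}

/-- `X₊(A) = X(A) ∩ X₊`. -/
def localizedPos (X : Submodule ℝ (L0 P)) {A : Set Ω} (hA : MeasurableSet A) : Set X :=
  localized X hA ∩ {g | 0 ≤ (g : L0 P)}

/-- `𝒜 = 𝒞 ⊕ 𝒟`: every element of `𝒜`, and nothing else, is a sum of an element of `𝒞` and
an element of `𝒟`, and these summands are unique. -/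
def IsDirectSum {E : Type*} [Add E] (𝒜 𝒞 𝒟 : Set E) : Prop :=
  𝒜 = 𝒞 + 𝒟 ∧
    ∀ c ∈ 𝒞, ∀ c' ∈ 𝒞, ∀ d ∈ 𝒟, ∀ d' ∈ 𝒟, c + d = c' + d' → c = c' ∧ d = d'

end SurplusInvariance

end

/-!
The forward implication rests on the family `𝓓` of events `B` with `-1_B ∈ 𝒜`. Since `𝒜` is a
monotone convex cone, `𝓓` is stable under finite unions, and since `𝒜` is closed and decreasing
almost sure limits are limits in `X` (`tendsto_of_antitone`), it is stable under countable unions.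
Hence `𝓓` has an element `B` of largest probability (`exists_maximal_neg_ind_mem`), and `A = Bᶜ`
is the required event.

If `f ∈ 𝒜` were negative on a non-null part of `A`, then `f ≤ -ε` on some non-null `C ⊆ A`;
surplus invariance and the cone property would put `C` in `𝓓`, and `B ∪ C` would contradict the
maximality of `B`. Conversely, if `1_A f ≥ 0`, the truncations `f ⊔ (-n)` dominate
`-n 1_B ∈ 𝒜` and decrease to `f`, so `f ∈ 𝒜`. Finally `P A > 0` because `𝒜 ≠ X`.

The ambient space enters only through these facts: it contains the indicators, is stable under
`⊔` and under multiplication by indicators, and satisfies `tendsto_of_antitone`. The reverse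
implication and the direct sum decomposition are pointwise computations.
-/

namespace SurplusInvariance

variable {Ω : Type*} [MeasurableSpace Ω] {P : Measure Ω} {X : Submodule ℝ (L0 P)}

/-! ### Pointwise descriptions -/

lemma coeFn_ind {A : Set Ω} (hA : MeasurableSet A) :
    ⇑(ind P hA) =ᵐ[P] A.indicator fun _ => (1 : ℝ) :=
  AEEqFun.coeFn_mk _ _

lemma coeFn_ind_mul {A : Set Ω} (hA : MeasurableSet A) (f : L0 P) :
    ⇑(ind P hA * f) =ᵐ[P] A.indicator f := by
  filter_upwards [AEEqFun.coeFn_mul (ind P hA) f, coeFn_ind (P := P) hA] with ω h1 h2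
  rw [h1, Pi.mul_apply, h2]
  by_cases h : ω ∈ A <;> simp [h]

lemma ind_mul_nonneg_iff {A : Set Ω} (hA : MeasurableSet A) (f : L0 P) :
    0 ≤ ind P hA * f ↔ ∀ᵐ ω ∂P, ω ∈ A → 0 ≤ f ω := by
  rw [← AEEqFun.coeFn_le]
  have h0 := AEEqFun.coeFn_zero (α := Ω) (β := ℝ) (μ := P)
  constructor
  · intro h
    filter_upwards [h, h0, coeFn_ind_mul hA f] with ω h1 h2 h3 hω
    simpa [h2, h3, hω] using h1
  · intro h
    filter_upwards [h, h0, coeFn_ind_mul hA f] with ω h1 h2 h3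
    rw [h2, h3]
    by_cases hω : ω ∈ A <;> simp [hω, h1]

lemma coeFn_negPart (f : L0 P) : ⇑(-f ⊔ 0) =ᵐ[P] fun ω => max (-f ω) 0 := by
  filter_upwards [AEEqFun.coeFn_sup (-f) 0, AEEqFun.coeFn_neg f,
    AEEqFun.coeFn_zero (α := Ω) (β := ℝ) (μ := P)] with ω h1 h2 h3
  rw [h1, h2, h3]; rfl

lemma negPart_le_negPart_iff (f g : L0 P) :
    -g ⊔ 0 ≤ -f ⊔ 0 ↔ ∀ᵐ ω ∂P, max (-g ω) 0 ≤ max (-f ω) 0 := by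
  rw [← AEEqFun.coeFn_le]
  constructor <;> intro h <;>
    filter_upwards [h, coeFn_negPart f, coeFn_negPart g] with ω h1 h2 h3 <;>
    simpa [h2, h3] using h1

lemma IsSurplusInvariant.mem_of_ae {𝒜 : Set X} (h : IsSurplusInvariant 𝒜) {f : X} (hf : f ∈ 𝒜)
    (g : X) (hg : ∀ᵐ ω ∂P, max (-(g : L0 P) ω) 0 ≤ max (-(f : L0 P) ω) 0) : g ∈ 𝒜 :=
  h f hf g ((negPart_le_negPart_iff _ _).2 hg)

/-! ### Properties shared by the ambient spaces -/

namespace IsAmbientSpace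

variable {τ : TopologicalSpace X}

lemma sup_mem (hX : IsAmbientSpace P X τ) {f g : L0 P} (hf : f ∈ X) (hg : g ∈ X) :
    f ⊔ g ∈ X := by
  cases hX with
  | linfty =>
    change f ⊔ g ∈ Lp ℝ ∞ P
    exact Lp.mem_Lp_iff_memLp.2 (((Lp.mem_Lp_iff_memLp.1 hf).sup (Lp.mem_Lp_iff_memLp.1 hg)).ae_eq
      (AEEqFun.coeFn_sup f g).symm)
  | frechet _ _ h => exact h.sup_mem f hf g hg

lemma linfty_mem (hX : IsAmbientSpace P X τ) {f : L0 P} (hf : f ∈ Lp ℝ ∞ P) : f ∈ X := by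
  cases hX with
  | linfty => exact hf
  | frechet _ _ h => exact h.linfty_mem ⟨f, hf⟩

lemma ind_mem [IsFiniteMeasure P] (hX : IsAmbientSpace P X τ) {A : Set Ω} (hA : MeasurableSet A) :
    ind P hA ∈ X :=
  hX.linfty_mem <| Lp.mem_Lp_iff_memLp.2 <|
    ((memLp_const (1 : ℝ)).indicator hA).ae_eq (coeFn_ind hA).symm

lemma ind_mul_mem (hX : IsAmbientSpace P X τ) {A : Set Ω} (hA : MeasurableSet A) {f : L0 P}
    (hf : f ∈ X) : ind P hA * f ∈ X := by
  cases hX with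
  | linfty =>
    change _ ∈ Lp ℝ ∞ P
    exact Lp.mem_Lp_iff_memLp.2 (((Lp.mem_Lp_iff_memLp.1 hf).indicator hA).ae_eq
      (coeFn_ind_mul hA f).symm)
  | frechet _ _ h => exact h.localization hA f hf

/-- Decreasing almost sure convergence implies convergence in the ambient space. For the weak-star
topology this is dominated convergence, the dominating function being `(|u 0| + |f|) |Z|`. -/
lemma tendsto_of_antitone (hX : IsAmbientSpace P X τ) (u : ℕ → X) (f : X)
    (hu : Antitone fun n => (u n : L0 P))
    (hlim : ∀ᵐ ω ∂P, Tendsto (fun n => (u n : L0 P) ω) atTop (𝓝 ((f : L0 P) ω))) :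
    Tendsto u atTop (@nhds X τ f) := by
  have hanti : ∀ᵐ ω ∂P, Antitone fun n => (u n : L0 P) ω := by
    have : ∀ᵐ ω ∂P, ∀ n, (u (n + 1) : L0 P) ω ≤ (u n : L0 P) ω :=
      ae_all_iff.2 fun n => AEEqFun.coeFn_le.2 (hu n.le_succ)
    exact this.mono fun ω h => antitone_nat_of_succ_le h
  cases hX with
  | linfty =>
    rw [nhds_induced, tendsto_comap_iff, tendsto_pi_nhds]
    intro Z
    have hint : ∀ g : Linfty P,
        Integrable (fun ω => |(g : L0 P) ω| * |(Z : L0 P) ω|) P := fun g => by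
      have hZ : MemLp (fun ω => (Z : L0 P) ω) 1 P := Lp.memLp Z
      have hg : MemLp (fun ω => (g : L0 P) ω) ∞ P := Lp.mem_Lp_iff_memLp.1 g.2
      have := (hZ.mul (r := 1) hg).norm
      simpa [abs_mul] using memLp_one_iff_integrable.1 this
    refine tendsto_integral_of_dominated_convergence
      (fun ω => |(u 0 : L0 P) ω| * |(Z : L0 P) ω| + |(f : L0 P) ω| * |(Z : L0 P) ω|)
      (fun n => ?_) ((hint _).add (hint _)) (fun n => ?_) ?_
    · exact (AEEqFun.aestronglyMeasurable _).mul (AEEqFun.aestronglyMeasurable _)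
    · filter_upwards [hlim, hanti] with ω h1 h2
      have hle : (f : L0 P) ω ≤ (u n : L0 P) ω := h2.le_of_tendsto h1 n
      have hle' : (u n : L0 P) ω ≤ (u 0 : L0 P) ω := h2 (Nat.zero_le n)
      rw [Real.norm_eq_abs, abs_mul, ← add_mul]
      refine mul_le_mul_of_nonneg_right (abs_le.2 ⟨?_, ?_⟩) (abs_nonneg _)
      · linarith [neg_abs_le ((f : L0 P) ω), abs_nonneg ((u 0 : L0 P) ω)]
      · linarith [le_abs_self ((u 0 : L0 P) ω), abs_nonneg ((f : L0 P) ω)]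
    · filter_upwards [hlim] with ω h using h.mul_const _
  | frechet _ _ h =>
    have := h.isTopologicalAddGroup
    have hsub : ∀ᵐ ω ∂P, ∀ n, ((u n - f : X) : L0 P) ω = (u n : L0 P) ω - (f : L0 P) ω :=
      ae_all_iff.2 fun n => AEEqFun.coeFn_sub _ _
    refine tendsto_sub_nhds_zero_iff.1 (h.sigmaLebesgue (fun n => u n - f) ?_ ?_)
    · intro m n hmn
      rw [← AEEqFun.coeFn_le]
      filter_upwards [hsub, hanti] with ω h1 h2
      rw [h1, h1]
      exact sub_le_sub_right (h2 hmn) _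
    · filter_upwards [hsub, hlim] with ω h1 h2
      simp only [h1]
      simpa only [sub_self] using h2.sub_const ((f : L0 P) ω)

end IsAmbientSpace

/-! ### Events whose negative indicator is acceptable -/

section NegInd

variable {τ : TopologicalSpace X} {𝒜 : Set X}

lemma IsCoherent.add_mem (h : IsCoherent 𝒜) {f g : X} (hf : f ∈ 𝒜) (hg : g ∈ 𝒜) :
    f + g ∈ 𝒜 := by
  have := h.cone _ (h.convex hf hg (a := 1 / 2) (b := 1 / 2) (by norm_num) (by norm_num)
    (by norm_num)) 2 (by norm_num)
  simpa [smul_smul] using this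

/-- The event `B` is measurable and the loss `-1_B` belongs to `𝒜`. -/
def NegIndMem (𝒜 : Set X) (B : Set Ω) : Prop :=
  ∃ hB : MeasurableSet B, ∃ f ∈ 𝒜, (f : L0 P) = -ind P hB

lemma coeFn_neg_ind {B : Set Ω} (hB : MeasurableSet B) :
    ⇑(-ind P hB) =ᵐ[P] fun ω => -B.indicator (fun _ => (1 : ℝ)) ω := by
  filter_upwards [AEEqFun.coeFn_neg (ind P hB), coeFn_ind (P := P) hB] with ω h1 h2
  rw [h1, Pi.neg_apply, h2]

variable [IsFiniteMeasure P]

lemma NegIndMem.union (hX : IsAmbientSpace P X τ) (hacc : IsAcceptanceSet 𝒜)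
    (hcoh : IsCoherent 𝒜) {B C : Set Ω} (hB : NegIndMem 𝒜 B) (hC : NegIndMem 𝒜 C) :
    NegIndMem 𝒜 (B ∪ C) := by
  obtain ⟨mB, f, hf, ef⟩ := hB
  obtain ⟨mC, g, hg, eg⟩ := hC
  refine ⟨mB.union mC, ⟨_, X.neg_mem (hX.ind_mem (mB.union mC))⟩,
    hacc.monotone _ (hcoh.add_mem hf hg) _ ?_, rfl⟩
  rw [Submodule.coe_add, ef, eg, ← AEEqFun.coeFn_le]
  filter_upwards [AEEqFun.coeFn_add (-ind P mB) (-ind P mC), coeFn_neg_ind (P := P) mB,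
    coeFn_neg_ind (P := P) mC, coeFn_neg_ind (P := P) (mB.union mC)] with ω h1 h2 h3 h4
  rw [h1, Pi.add_apply, h2, h3, h4]
  by_cases hb : ω ∈ B <;> by_cases hc : ω ∈ C <;> simp [hb, hc]

lemma NegIndMem.iUnion_of_monotone (hX : IsAmbientSpace P X τ) (hclosed : IsClosed[τ] 𝒜)
    {B : ℕ → Set Ω} (hmono : Monotone B) (hB : ∀ n, NegIndMem 𝒜 (B n)) :
    NegIndMem 𝒜 (⋃ n, B n) := by
  choose mB f hf ef using hB
  have mU : MeasurableSet (⋃ n, B n) := .iUnion mB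
  have hco : ∀ᵐ ω ∂P, ∀ n, (f n : L0 P) ω = -(B n).indicator (fun _ => (1 : ℝ)) ω :=
    ae_all_iff.2 fun n => by rw [ef]; exact coeFn_neg_ind (mB n)
  refine ⟨mU, ⟨_, X.neg_mem (hX.ind_mem mU)⟩,
    hclosed.mem_of_tendsto (hX.tendsto_of_antitone f _ ?_ ?_) (.of_forall hf), rfl⟩
  · intro m n hmn
    rw [← AEEqFun.coeFn_le]
    filter_upwards [hco] with ω h
    rw [h, h]
    exact neg_le_neg
      (Set.indicator_le_indicator_of_subset (hmono hmn) (fun _ => zero_le_one) ω)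
  · filter_upwards [hco, coeFn_neg_ind (P := P) mU] with ω h1 h2
    simp only [h1, h2]
    exact ((Monotone.tendsto_indicator B hmono _ ω).mono_right (pure_le_nhds _)).neg

/-- Among the events `B` with `-1_B ∈ 𝒜` there is one of largest measure. -/
lemma exists_maximal_neg_ind_mem (hX : IsAmbientSpace P X τ) (hclosed : IsClosed[τ] 𝒜)
    (hacc : IsAcceptanceSet 𝒜) (hcoh : IsCoherent 𝒜) (h0 : (0 : X) ∈ 𝒜) :
    ∃ B, NegIndMem 𝒜 B ∧ ∀ C, NegIndMem 𝒜 C → P C ≤ P B := by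
  have hempty : NegIndMem 𝒜 (∅ : Set Ω) := by
    refine ⟨.empty, 0, h0, AEEqFun.ext ?_⟩
    filter_upwards [coeFn_neg_ind (P := P) (.empty (α := Ω)),
      AEEqFun.coeFn_zero (α := Ω) (β := ℝ) (μ := P)] with ω h1 h2
    rw [h1, Submodule.coe_zero, h2]
    simp
  obtain ⟨v, -, hv, hvmem⟩ := exists_seq_tendsto_sSup (S := P '' {B | NegIndMem 𝒜 B})
    ⟨_, ∅, hempty, rfl⟩ (OrderTop.bddAbove _)
  choose C hC hCv using hvmem
  have hacc' : ∀ n, NegIndMem 𝒜 (Set.accumulate C n) := by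
    intro n
    induction n with
    | zero => simpa using hC 0
    | succ n ih => rw [Set.accumulate_succ]; exact ih.union hX hacc hcoh (hC _)
  refine ⟨⋃ n, Set.accumulate C n,
    NegIndMem.iUnion_of_monotone hX hclosed Set.monotone_accumulate hacc', fun D hD => ?_⟩
  refine (le_sSup (Set.mem_image_of_mem P hD)).trans (le_of_tendsto' hv fun n => ?_)
  rw [← hCv]
  exact measure_mono
    ((Set.subset_accumulate (s := C) (x := n)).trans (Set.subset_iUnion (Set.accumulate C) n))

end NegInd

/-! ### The two implications -/

lemma isSurplusInvariant_setOf_ind_mul_nonneg {A : Set Ω} (hA : MeasurableSet A) :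
    IsSurplusInvariant {f : X | 0 ≤ ind P hA * (f : L0 P)} := by
  intro f hf g hg
  rw [Set.mem_ofPred_eq, ind_mul_nonneg_iff] at hf ⊢
  filter_upwards [hf, (negPart_le_negPart_iff _ _).1 hg] with ω h1 h2 hω
  have := h1 hω
  rw [max_eq_right (a := -(f : L0 P) ω) (by linarith)] at h2
  linarith [(max_le_iff.1 h2).1]

lemma isDirectSum_setOf_ind_mul_nonneg {τ : TopologicalSpace X} (hX : IsAmbientSpace P X τ)
    {A : Set Ω} (hA : MeasurableSet A) :
    IsDirectSum {f : X | 0 ≤ ind P hA * (f : L0 P)} (localizedPos X hA)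
      (localized X hA.compl) := by
  have hc : ∀ c ∈ localized X hA, ∀ᵐ ω ∂P, ω ∉ A → (c : L0 P) ω = 0 := by
    rintro c ⟨f, hf⟩
    rw [hf]
    filter_upwards [coeFn_ind_mul hA (f : L0 P)] with ω h hω
    simp [h, hω]
  have hd : ∀ d ∈ localized X hA.compl, ∀ᵐ ω ∂P, ω ∈ A → (d : L0 P) ω = 0 := by
    rintro d ⟨f, hf⟩
    rw [hf]
    filter_upwards [coeFn_ind_mul hA.compl (f : L0 P)] with ω h hω
    simp [h, hω]
  refine ⟨Set.Subset.antisymm (fun f hf => ?_) ?_, ?_⟩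
  · refine ⟨⟨_, hX.ind_mul_mem hA f.2⟩, ⟨⟨f, rfl⟩, hf⟩, ⟨_, hX.ind_mul_mem hA.compl f.2⟩,
      ⟨f, rfl⟩, Subtype.ext (AEEqFun.ext ?_)⟩
    filter_upwards [AEEqFun.coeFn_add (ind P hA * (f : L0 P)) (ind P hA.compl * (f : L0 P)),
      coeFn_ind_mul hA (f : L0 P), coeFn_ind_mul hA.compl (f : L0 P)] with ω h1 h2 h3
    change (ind P hA * (f : L0 P) + ind P hA.compl * (f : L0 P)) ω = _
    rw [h1, Pi.add_apply, h2, h3]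
    exact congrFun (Set.indicator_self_add_compl A _) ω
  · rintro _ ⟨c, ⟨-, hc0⟩, d, hd', rfl⟩
    have hc0' := AEEqFun.coeFn_le.2 hc0
    rw [Set.mem_ofPred_eq, ind_mul_nonneg_iff]
    filter_upwards [hc0', hd d hd', AEEqFun.coeFn_add (c : L0 P) d,
      AEEqFun.coeFn_zero (α := Ω) (β := ℝ) (μ := P)] with ω h1 h2 h3 h4 hω
    change 0 ≤ ((c : L0 P) + (d : L0 P)) ω
    rw [h4] at h1
    rw [h3, Pi.add_apply, h2 hω, add_zero]
    exact h1
  · intro c hcm c' hcm' d hdm d' hdm' heq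
    -- On `A` both sides reduce to `c` and `c'`, off `A` these vanish.
    have hcc : c = c' := by
      refine Subtype.ext (AEEqFun.ext ?_)
      have heq' : (c : L0 P) + d = c' + d' := congrArg Subtype.val heq
      filter_upwards [hc c hcm.1, hc c' hcm'.1, hd d hdm, hd d' hdm',
        AEEqFun.coeFn_add (c : L0 P) d, AEEqFun.coeFn_add (c' : L0 P) d'] with ω h1 h2 h3 h4 h5 h6
      by_cases hω : ω ∈ A
      · rw [heq', h6] at h5
        simpa [h3 hω, h4 hω] using h5.symm
      · rw [h1 hω, h2 hω]
    exact ⟨hcc, by simpa [hcc] using heq⟩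

/-- If `f ∈ 𝒜` is negative on a non-null part of the complement of `B`, then some event with
acceptable negative indicator is disjoint from `B` and non-null. -/
lemma exists_negIndMem_of_neg [IsFiniteMeasure P] {τ : TopologicalSpace X} {𝒜 : Set X}
    (hX : IsAmbientSpace P X τ) (hcoh : IsCoherent 𝒜) (hsi : IsSurplusInvariant 𝒜) {B : Set Ω}
    (hB : MeasurableSet B) {f : X} (hf : f ∈ 𝒜) (hneg : ¬∀ᵐ ω ∂P, ω ∈ Bᶜ → 0 ≤ (f : L0 P) ω) :
    ∃ C, NegIndMem 𝒜 C ∧ Disjoint B C ∧ P C ≠ 0 := by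
  obtain ⟨k, hk⟩ : ∃ k : ℕ, P (Bᶜ ∩ {ω | (f : L0 P) ω ≤ -(1 / (k + 1 : ℝ))}) ≠ 0 := by
    by_contra! h
    refine hneg ?_
    have h' : ∀ᵐ ω ∂P, ∀ k : ℕ, ω ∉ Bᶜ ∩ {ω | (f : L0 P) ω ≤ -(1 / (k + 1 : ℝ))} :=
      ae_all_iff.2 fun k => measure_eq_zero_iff_ae_notMem.1 (h k)
    filter_upwards [h'] with ω hω hωB
    by_contra! hlt
    obtain ⟨k, hk⟩ := exists_nat_one_div_lt (neg_pos.2 hlt)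
    exact hω k ⟨hωB, by simp only [Set.mem_ofPred_eq]; linarith⟩
  set C := Bᶜ ∩ {ω | (f : L0 P) ω ≤ -(1 / (k + 1 : ℝ))}
  have mC : MeasurableSet C :=
    hB.compl.inter (measurableSet_le (AEEqFun.measurable _) measurable_const)
  have hpos : (0 : ℝ) < k + 1 := by positivity
  refine ⟨C, ⟨mC, ⟨_, X.neg_mem (hX.ind_mem mC)⟩, ?_, rfl⟩,
    Set.disjoint_left.2 fun ω hω hC => hC.1 hω, hk⟩
  -- The negative part of `(k + 1) f` is at least `1` on `C`, so it dominates that of `-1_C`.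
  have hmem : (k + 1 : ℝ) • f ∈ 𝒜 := hcoh.cone f hf _ hpos
  refine hsi.mem_of_ae hmem _ ?_
  filter_upwards [coeFn_neg_ind (P := P) mC, AEEqFun.coeFn_smul (k + 1 : ℝ) (f : L0 P)]
    with ω h1 h2
  change max (-(-ind P mC) ω) 0 ≤ max (-((k + 1 : ℝ) • (f : L0 P)) ω) 0
  rw [h1, h2, neg_neg, Pi.smul_apply, smul_eq_mul]
  by_cases hω : ω ∈ C
  · have h3 : (f : L0 P) ω ≤ -(1 / (k + 1 : ℝ)) := hω.2
    have h4 := mul_le_mul_of_nonneg_left h3 hpos.le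
    rw [mul_neg, mul_one_div_cancel hpos.ne'] at h4
    rw [Set.indicator_of_mem hω]
    exact max_le (le_max_of_le_left (by linarith)) (le_max_right _ _)
  · simp [hω]

/-- Random variables that are non-negative off `B` are acceptable: their truncations from below
dominate multiples of `-1_B`. -/
lemma NegIndMem.mem_of_nonneg_compl [IsFiniteMeasure P] {τ : TopologicalSpace X} {𝒜 : Set X}
    (hX : IsAmbientSpace P X τ) (hclosed : IsClosed[τ] 𝒜) (hacc : IsAcceptanceSet 𝒜)
    (hcoh : IsCoherent 𝒜) {B : Set Ω} (hB : NegIndMem 𝒜 B) {f : X}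
    (hf : ∀ᵐ ω ∂P, ω ∈ Bᶜ → 0 ≤ (f : L0 P) ω) : f ∈ 𝒜 := by
  obtain ⟨mB, b, hb, eb⟩ := hB
  have hmem (n : ℕ) : (f : L0 P) ⊔ (n + 1 : ℝ) • -ind P .univ ∈ X :=
    hX.sup_mem f.2 (X.smul_mem _ (X.neg_mem (hX.ind_mem .univ)))
  have hco : ∀ᵐ ω ∂P, ∀ n : ℕ, ((f : L0 P) ⊔ (n + 1 : ℝ) • -ind P .univ) ω
      = max ((f : L0 P) ω) (-(n + 1)) := by
    refine ae_all_iff.2 fun n => ?_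
    filter_upwards [AEEqFun.coeFn_sup (f : L0 P) ((n + 1 : ℝ) • -ind P .univ),
      AEEqFun.coeFn_smul (n + 1 : ℝ) (-ind P .univ), coeFn_neg_ind (P := P) .univ] with ω h1 h2 h3
    rw [h1, h2, Pi.smul_apply, h3]
    simp
  refine hclosed.mem_of_tendsto
    (hX.tendsto_of_antitone (fun n => ⟨_, hmem n⟩) f ?_ ?_) (.of_forall fun n => ?_)
  · intro m n hmn
    rw [← AEEqFun.coeFn_le]
    filter_upwards [hco] with ω h
    rw [h, h]
    have : (m : ℝ) ≤ n := by exact_mod_cast hmn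
    exact max_le_max_left _ (by linarith)
  · filter_upwards [hco] with ω h
    refine tendsto_const_nhds.congr' ?_
    obtain ⟨N, hN⟩ := exists_nat_ge (-(f : L0 P) ω)
    filter_upwards [eventually_ge_atTop N] with n hn
    have : (N : ℝ) ≤ n := by exact_mod_cast hn
    rw [h, max_eq_left (by linarith)]
  · refine hacc.monotone _ (hcoh.cone b hb (n + 1) (by positivity)) _ ?_
    rw [Submodule.coe_smul, eb, ← AEEqFun.coeFn_le]
    filter_upwards [hco, hf, AEEqFun.coeFn_smul (n + 1 : ℝ) (-ind P mB),
      coeFn_neg_ind (P := P) mB] with ω h1 h2 h3 h4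
    rw [h1, h3, Pi.smul_apply, h4]
    by_cases hω : ω ∈ B
    · simp [hω]
    · simpa [hω] using Or.inl (h2 hω)

end SurplusInvariance

theorem mainTheorem2 {Ω : Type*} [MeasurableSpace Ω] (P : Measure Ω) [IsProbabilityMeasure P]
    (X : Submodule ℝ (SurplusInvariance.L0 P)) (τ : TopologicalSpace X)
    (hX : SurplusInvariance.IsAmbientSpace P X τ)
    (𝒜 : Set X) (hclosed : IsClosed[τ] 𝒜)
    (hacc : SurplusInvariance.IsAcceptanceSet 𝒜)
    (hcoh : SurplusInvariance.IsCoherent 𝒜) :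
    SurplusInvariance.IsSurplusInvariant 𝒜 ↔
      ∃ (A : Set Ω) (hA : MeasurableSet A), 0 < P A ∧
        SurplusInvariance.IsDirectSum 𝒜 (SurplusInvariance.localizedPos X hA)
          (SurplusInvariance.localized X hA.compl) ∧
        𝒜 = {f : X | 0 ≤ SurplusInvariance.ind P hA * (f : SurplusInvariance.L0 P)} := by
  open SurplusInvariance in
  constructor
  · intro hsi
    have h0 : (0 : X) ∈ 𝒜 := by
      obtain ⟨f, hf⟩ := hacc.nonempty
      refine hsi f hf 0 ?_
      simp
    obtain ⟨B, hB, hmax⟩ := exists_maximal_neg_ind_mem hX hclosed hacc hcoh h0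
    obtain ⟨mB, -⟩ := id hB
    have hrep : 𝒜 = {f : X | 0 ≤ ind P mB.compl * (f : L0 P)} := by
      ext f
      rw [Set.mem_ofPred_eq, ind_mul_nonneg_iff]
      refine ⟨fun hf => ?_, hB.mem_of_nonneg_compl hX hclosed hacc hcoh⟩
      by_contra hneg
      obtain ⟨C, hC, hdisj, hC0⟩ := exists_negIndMem_of_neg hX hcoh hsi mB hf hneg
      have hle := hmax _ (hB.union hX hacc hcoh hC)
      rw [measure_union hdisj hC.1] at hle
      exact hle.not_gt (ENNReal.lt_add_right (measure_ne_top P B) hC0)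
    refine ⟨Bᶜ, mB.compl, pos_iff_ne_zero.2 fun hzero => hacc.ne_univ ?_, ?_, hrep⟩
    · rw [hrep, Set.eq_univ_iff_forall]
      intro f
      rw [Set.mem_ofPred_eq, ind_mul_nonneg_iff]
      filter_upwards [measure_eq_zero_iff_ae_notMem.1 hzero] with ω h hω using absurd hω h
    · rw [hrep]
      exact isDirectSum_setOf_ind_mul_nonneg hX mB.compl
  · rintro ⟨A, hA, -, -, rfl⟩
    exact isSurplusInvariant_setOf_ind_mul_nonneg hA
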